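/- Let $\mathbb K=\mathbb R$ or $\mathbb C$, let $D=d$ if $\mathbb K=\mathbb R$ and $D=2d$ if $\mathbb K=\mathbb C$, and let $\mathcal{HP}_d^+(\mathbb K)$ be the set of positive definite symmetric (Hermitian if $\mathbb K=\mathbb C$) $d\times d$ matrices over $\mathbb K$ of determinant $1$. For a positive definite $\Sigma$ let $s^{\Sigma}$ be the angular law of correlation matrix $\Sigma$, i.e. the law of $\Sigma^{1/2}u/\|\Sigma^{1/2}u\|$ with $u$ uniform on the unit sphere of $\mathbb K^d$; let $$\mathrm{anscm}(\Sigma)=\int \frac{yy^\dagger}{y^\dagger y}\,ds^{\Sigma}(y)$$ be the mean of the normalized sample covariance matrix, and for $R_0,R\in\mathcal{HP}_d^+(\mathbb K)$ let $$H(R_0|R)=\frac{D-1}{2}\int\log\frac{x^\dagger R^{-1}x}{x^\dagger R_0^{-1}x}\,ds^{R_0}(x)$$ be the relative entropy of angular models in the normalization of the likelihood concentrated over the radial law (that is, $(1-\tfrac1D)$ times the Kullback–Leibler divergence of $s^{R_0}$ from $s^{R}$). Let $N\ge 1$, $\alpha\in[0,1]$, $R_{\mathrm{prior}}\in\mathcal{HP}_d^+(\mathbb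 K)$, and let $x_1,\dots,x_N\in\mathbb K^d$ be nonzero. For elliptical models with correlation matrix $R\in\mathcal{HP}_d^+(\mathbb K)$ and unknown radial law, define the concentrated regularized log-likelihood, up to an additive constant independent of $R$, by $$l(R)=-\frac{\alpha(d-1)}{2N}\sum_{n=1}^N\log\left(x_n^\dagger R^{-1}x_n\right)-(1-\alpha)H(R_{\mathrm{prior}}|R)\qquad(\mathbb K=\mathbb R),$$ $$l(R)=-\frac{\alpha(d-1)}{N}\sum_{n=1}^N\log\left(x_n^\dagger R^{-1}x_n\right)-(1-\alpha)H(R_{\mathrm{prior}}|R)\qquad(\mathbb K=\mathbb C,\ \text{circular case}).$$ Call $R\in\mathcal{HP}_d^+(\mathbb K)$ a stationary point of $l$ under the unit-determinant constraint if, for every curve $\gamma$ with $\gamma(0)=R$ that takes values in $\mathcal{HP}_d^+(\mathbb K)$ near $0$ and is differentiable at $0$, the function $l\circ\gamma$ is differentiable at $0$ with derivative $0$. (i) If $\mathbb K=\mathbb R$, then $R\in\mathcal{HP}_d^+(\mathbb R)$ is a stationary point of $l$ if and only if $$R\;\propto\;(1-\alpha)\,R^{1/2}\,\mathrm{anscm}\!\left(R^{-1/2}R_{\mathrm{prior}}R^{-1/2}\right)R^{1/2}+\frac{\alpha}{N}\sum_{n=1}^N\frac{x_nx_n^\dagger}{x_n^\dagger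 R^{-1}x_n},$$ where $\propto$ means equality up to a positive real factor. (ii) If $\mathbb K=\mathbb C$ (circular case), then $R\in\mathcal{HP}_d^+(\mathbb C)$ is a stationary point of $l$ if and only if it satisfies the same equation, over $\mathbb C$, with $\alpha$ replaced by $$\alpha'=\frac{\alpha(d-1)}{d-\frac12(1+\alpha)}$$ (with $\alpha'=0$ in the degenerate case $d=1$, $\alpha=1$). -/

import Mathlib

open scoped MatrixOrder ComplexOrder

noncomputable section

namespace RegTyler

open MeasureTheory Matrix

/-- Positive definite symmetric (`𝕜 = ℝ`) or Hermitian (`𝕜 = ℂ`) matrices of unit determinant: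
the parameter space of correlation matrices. -/
def HP (𝕜 : Type*) [RCLike 𝕜] (d : ℕ) : Set (Matrix (Fin d) (Fin d) 𝕜) :=
  {R | R.PosDef ∧ R.det = 1}

/-- The quadratic form `x† R⁻¹ x`, which is real for Hermitian `R`. -/
def quad {𝕜 : Type*} [RCLike 𝕜] {d : ℕ} (R : Matrix (Fin d) (Fin d) 𝕜)
    (x : EuclideanSpace 𝕜 (Fin d)) : ℝ :=
  RCLike.re (star (fun i => x i) ⬝ᵥ (R⁻¹ *ᵥ fun i => x i))

/-- The isotropic probability measure on the unit sphere of `𝕜^d`, i.e. normalised surface measure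
(the sphere has real dimension `d - 1` if `𝕜 = ℝ` and `2 d - 1` if `𝕜 = ℂ`). -/
def uniformSphere (𝕜 : Type*) [RCLike 𝕜] (d : ℕ) :
    Measure (Metric.sphere (0 : EuclideanSpace 𝕜 (Fin d)) 1) :=
  ((Measure.addHaar : Measure (EuclideanSpace 𝕜 (Fin d))).toSphere Set.univ)⁻¹ •
    (Measure.addHaar : Measure (EuclideanSpace 𝕜 (Fin d))).toSphere

/-- The angular law with correlation matrix `R`: the law on the unit sphere of `L u / ‖L u‖`, where
`u` is uniform on the unit sphere and `L = R^{1/2}` (the law is the same for any `L` with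
`L L† = R`). -/
def angularLaw {𝕜 : Type*} [RCLike 𝕜] {d : ℕ} (R : Matrix (Fin d) (Fin d) 𝕜) :
    Measure (EuclideanSpace 𝕜 (Fin d)) :=
  Measure.map (fun u : Metric.sphere (0 : EuclideanSpace 𝕜 (Fin d)) 1 =>
    NormedSpace.normalize (Matrix.toEuclideanLin (CFC.sqrt R) (u : EuclideanSpace 𝕜 (Fin d))))
    (uniformSphere 𝕜 d)

/-- The mean of the normalised sample covariance `y y† / (y† y)` when `y` follows the angular law
of correlation matrix `S` (equivalently, any elliptical law with that correlation matrix). -/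
def anscm {𝕜 : Type*} [RCLike 𝕜] {d : ℕ} (S : Matrix (Fin d) (Fin d) 𝕜) :
    Matrix (Fin d) (Fin d) 𝕜 :=
  Matrix.of fun i j => ∫ y, y i * star (y j) / ((‖y‖ ^ 2 : ℝ) : 𝕜) ∂(angularLaw S)

/-- The relative entropy `H(R₀|R)` of angular models, for `|R₀| = |R| = 1`:
`(D - 1)/2 ∫ log (x† R⁻¹ x / x† R₀⁻¹ x) ds^{R₀}(x)`, with `D` the real dimension of the space
(`D = d` for `ℝ^d`, `D = 2 d` for `ℂ^d`). The factor `D - 1` is that of the likelihood concentrated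
over the radial law: `H(R₀|R)` is the mean under `s^{R₀}` of the concentrated log-likelihood ratio
of `R₀` against `R`. -/
def angularEntropy {𝕜 : Type*} [RCLike 𝕜] {d : ℕ} (R₀ R : Matrix (Fin d) (Fin d) 𝕜) : ℝ :=
  ((Module.finrank ℝ 𝕜 : ℝ) * d - 1) / 2 * ∫ x, Real.log (quad R x / quad R₀ x) ∂(angularLaw R₀)

/-- The concentrated regularised log-likelihood in the real case, up to an additive constant
independent of `R`. -/
def realLikelihood {d N : ℕ} (α : ℝ) (Rprior : Matrix (Fin d) (Fin d) ℝ)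
    (x : Fin N → EuclideanSpace ℝ (Fin d)) (R : Matrix (Fin d) (Fin d) ℝ) : ℝ :=
  -(α * ((d : ℝ) - 1) / (2 * N)) * ∑ n, Real.log (quad R (x n))
    - (1 - α) * angularEntropy Rprior R

/-- The concentrated regularised log-likelihood in the complex circular case, each sample being
known up to a phase, up to an additive constant independent of `R`. The `2 d - 1` of the real
space `ℂ^d ≃ ℝ^{2 d}` becomes `2 d - 2` for the samples because of the phase. -/
def complexLikelihood {d N : ℕ} (α : ℝ) (Rprior : Matrix (Fin d) (Fin d) ℂ)
    (x : Fin N → EuclideanSpace ℂ (Fin d)) (R : Matrix (Fin d) (Fin d) ℂ) : ℝ :=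
  -(α * (2 * (d : ℝ) - 2) / (2 * N)) * ∑ n, Real.log (quad R (x n))
    - (1 - α) * angularEntropy Rprior R

/-- `R` is a stationary point of `l` under the unit-determinant constraint: `l` has zero derivative
at `R` along every curve in `HP 𝕜 d` that passes through `R` and is differentiable there. -/
def IsStationary {𝕜 : Type*} [RCLike 𝕜] {d : ℕ} (l : Matrix (Fin d) (Fin d) 𝕜 → ℝ)
    (R : Matrix (Fin d) (Fin d) 𝕜) : Prop :=
  R ∈ HP 𝕜 d ∧
    ∀ γ : ℝ → Matrix (Fin d) (Fin d) 𝕜, γ 0 = R → (∀ᶠ t in nhds 0, γ t ∈ HP 𝕜 d) →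
      (∀ i j, DifferentiableAt ℝ (fun t => γ t i j) 0) → HasDerivAt (fun t => l (γ t)) 0 0

/-- The right-hand side of the regularised Tyler fixed-point equation:
`(1 - α) R^{1/2} anscm(R^{-1/2} Rprior R^{-1/2}) R^{1/2} + (α / N) ∑ xₙ xₙ† / (xₙ† R⁻¹ xₙ)`. -/
def tylerMap {𝕜 : Type*} [RCLike 𝕜] {d N : ℕ} (α : ℝ) (Rprior : Matrix (Fin d) (Fin d) 𝕜)
    (x : Fin N → EuclideanSpace 𝕜 (Fin d)) (R : Matrix (Fin d) (Fin d) 𝕜) :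
    Matrix (Fin d) (Fin d) 𝕜 :=
  (1 - α) • (CFC.sqrt R * anscm ((CFC.sqrt R)⁻¹ * Rprior * (CFC.sqrt R)⁻¹) * CFC.sqrt R)
    + (α / N) • ∑ n, (quad R (x n))⁻¹ •
        Matrix.vecMulVec (fun i => x n i) (star fun i => x n i)

end RegTyler

end

/-! Both likelihoods are, up to bookkeeping, `likelihood (s * β) (s * (1 - β))`, with `s` the total
weight and `β` the share of the samples. Write `M` for `tylerMap β R₀ x R`. Since `R⁻¹` has
derivative `-R⁻¹ V R⁻¹`, each term `log (x† R⁻¹ x)` contributes `-tr (R⁻¹ V R⁻¹ S)` with `S = x x† /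
(x† R⁻¹ x)`. Averaging over samples and prior gives the derivative `s * re tr (R⁻¹ V R⁻¹ M)`
(`hasDerivAt_likelihood`).

This uses that the `anscm` term of `M` is the mean of `S` under the prior law
(`sqrt_mul_anscm_mul_sqrt`): `S` is equivariant under linear maps, and a unitary factor does not
change the uniform law on the sphere.

Jacobi's formula makes tangent vectors satisfy `tr (R⁻¹ V) = 0`, so `M` proportional to `R` implies
stationarity. Conversely, diagonalise `R` and `M` simultaneously and move along the traceless part
of `M` relative to `R`: the derivative is `s` times the sum of squares of its eigenvalues, so that
part vanishes if `s > 0`. The identity `re tr (R⁻¹ M) = 1` then fixes the factor. -/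

noncomputable section

namespace RegTyler

open MeasureTheory Matrix

/-! ### Unitary invariance of the uniform law on the sphere. -/

section Sphere

variable {𝕜 : Type*} [RCLike 𝕜] {d : ℕ}

/-- Linear isometries of `𝕜^d` preserve Haar measure. -/
lemma measurePreserving_addHaar (e : EuclideanSpace 𝕜 (Fin d) ≃ₗᵢ[𝕜] EuclideanSpace 𝕜 (Fin d)) :
    MeasurePreserving e (Measure.addHaar : Measure (EuclideanSpace 𝕜 (Fin d)))
      Measure.addHaar := by
  refine ⟨e.continuous.measurable, ?_⟩
  set μ : Measure (EuclideanSpace 𝕜 (Fin d)) := Measure.addHaar with hμ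
  have : (μ.map e).IsAddHaarMeasure :=
    AddEquiv.isAddHaarMeasure_map μ e.toLinearEquiv.toAddEquiv e.continuous e.symm.continuous
  obtain ⟨c, hc⟩ : ∃ c : ENNReal, μ.map e = c • μ :=
    ⟨_, Measure.isAddLeftInvariant_eq_smul (μ.map e) μ⟩
  -- The unit ball is invariant and has positive finite volume, which forces the Haar scaling
  -- constant to be 1.
  have hb : (μ.map e) (Metric.ball 0 1) = μ (Metric.ball 0 1) := by
    rw [Measure.map_apply e.continuous.measurable Metric.isOpen_ball.measurableSet]
    congr 1
    simp
  have h0 : μ (Metric.ball 0 1) ≠ 0 := (Metric.measure_ball_pos μ 0 one_pos).ne'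
  have h1 : μ (Metric.ball 0 1) ≠ ⊤ := measure_ball_lt_top.ne
  have hc1 : c = 1 := by
    rw [hc, Measure.smul_apply, smul_eq_mul] at hb
    exact (ENNReal.mul_eq_right h0 h1).1 hb
  rw [hc, hc1, one_smul]

/-- A linear isometry restricted to the unit sphere. -/
def sphereHomeomorph (e : EuclideanSpace 𝕜 (Fin d) ≃ₗᵢ[𝕜] EuclideanSpace 𝕜 (Fin d)) :
    Metric.sphere (0 : EuclideanSpace 𝕜 (Fin d)) 1 ≃ₜ
      Metric.sphere (0 : EuclideanSpace 𝕜 (Fin d)) 1 :=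
  e.toHomeomorph.subtype (fun x => by simp)

lemma coe_sphereHomeomorph (e : EuclideanSpace 𝕜 (Fin d) ≃ₗᵢ[𝕜] EuclideanSpace 𝕜 (Fin d))
    (u : Metric.sphere (0 : EuclideanSpace 𝕜 (Fin d)) 1) :
    (sphereHomeomorph e u : EuclideanSpace 𝕜 (Fin d)) = e u := rfl

-- The surface measure of `s` is a fixed multiple of the volume of the cone `(0, 1) • s`, and a
-- linear isometry maps cones to cones while preserving volume.
open scoped Pointwise in
lemma measurePreserving_uniformSphere
    (e : EuclideanSpace 𝕜 (Fin d) ≃ₗᵢ[𝕜] EuclideanSpace 𝕜 (Fin d)) :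
    MeasurePreserving (sphereHomeomorph e) (uniformSphere 𝕜 d) (uniformSphere 𝕜 d) := by
  refine ⟨(sphereHomeomorph e).continuous.measurable, ?_⟩
  rw [uniformSphere, Measure.map_smul]
  congr 1
  ext s hs
  rw [Measure.map_apply (sphereHomeomorph e).continuous.measurable hs,
    Measure.toSphere_apply' _ hs,
    Measure.toSphere_apply' _ ((sphereHomeomorph e).continuous.measurable hs)]
  congr 1
  refine Eq.trans ?_ (MeasurePreserving.measure_preimage_equiv
    (f := e.toHomeomorph.toMeasurableEquiv) (measurePreserving_addHaar e)
    (Set.Ioo (0 : ℝ) 1 • (Subtype.val '' s)))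
  congr 1
  ext x
  constructor
  · rintro ⟨r, hr, y, ⟨u, hu, rfl⟩, rfl⟩
    exact ⟨r, hr, _, ⟨_, hu, rfl⟩,
      ((e.toLinearEquiv.restrictScalars ℝ).map_smul r _).symm⟩
  · rintro ⟨r, hr, y, ⟨u, hu, rfl⟩, hx⟩
    refine ⟨r, hr, _, ⟨(sphereHomeomorph e).symm u, by simpa using hu, rfl⟩, ?_⟩
    apply e.injective
    have h := coe_sphereHomeomorph e ((sphereHomeomorph e).symm u)
    rw [Homeomorph.apply_symm_apply] at h
    refine Eq.trans ?_ hx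
    show e (r • _) = r • _
    rw [h]
    exact (e.toLinearEquiv.restrictScalars ℝ).map_smul r _

lemma isProbabilityMeasure_uniformSphere (hd : 0 < d) :
    IsProbabilityMeasure (uniformSphere 𝕜 d) := by
  have : Nonempty (Fin d) := ⟨⟨0, hd⟩⟩
  have h0 : (Measure.addHaar : Measure (EuclideanSpace 𝕜 (Fin d))).toSphere Set.univ ≠ 0 := by
    rw [Measure.measure_univ_ne_zero]
    exact Measure.toSphere_ne_zero _
  refine ⟨?_⟩
  rw [uniformSphere, Measure.smul_apply, smul_eq_mul]
  exact ENNReal.inv_mul_cancel h0 (measure_ne_top _ _)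

end Sphere

/-! ### Mean scatter matrices under the angular law, and the prior term. -/

section Prior

variable {𝕜 : Type*} [RCLike 𝕜] {d : ℕ}

lemma sqrt_isHermitian (S : Matrix (Fin d) (Fin d) 𝕜) : (CFC.sqrt S)ᴴ = CFC.sqrt S :=
  (CFC.sqrt_nonneg S).posSemidef.1

lemma sqrt_mul_sqrt {S : Matrix (Fin d) (Fin d) 𝕜} (hS : S.PosSemidef) :
    CFC.sqrt S * CFC.sqrt S = S :=
  CFC.sqrt_mul_sqrt_self S hS.nonneg

lemma isUnit_det_sqrt {S : Matrix (Fin d) (Fin d) 𝕜} (hS : S.PosDef) :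
    IsUnit (CFC.sqrt S).det := by
  have h : IsUnit (CFC.sqrt S * CFC.sqrt S).det := by
    rw [sqrt_mul_sqrt hS.posSemidef]
    exact hS.det_pos.ne'.isUnit
  rw [det_mul] at h
  exact isUnit_of_mul_isUnit_left h

/-- The linear isometry of `𝕜^d` given by a unitary matrix. -/
def unitaryIsometry (U : Matrix (Fin d) (Fin d) 𝕜) (hU : Uᴴ * U = 1) :
    EuclideanSpace 𝕜 (Fin d) ≃ₗᵢ[𝕜] EuclideanSpace 𝕜 (Fin d) :=
  ((Matrix.toEuclideanLin U).isometryOfInner fun x y => by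
    rw [← LinearMap.adjoint_inner_right, ← Matrix.toEuclideanLin_conjTranspose_eq_adjoint]
    congr 1
    ext i
    simp [Matrix.mulVec_mulVec, hU]).toLinearIsometryEquiv rfl

lemma unitaryIsometry_apply (U : Matrix (Fin d) (Fin d) 𝕜) (hU : Uᴴ * U = 1)
    (x : EuclideanSpace 𝕜 (Fin d)) : unitaryIsometry U hU x = Matrix.toEuclideanLin U x := rfl

lemma toEuclideanLin_mul (A B : Matrix (Fin d) (Fin d) 𝕜) (x : EuclideanSpace 𝕜 (Fin d)) :
    Matrix.toEuclideanLin (A * B) x = Matrix.toEuclideanLin A (Matrix.toEuclideanLin B x) := by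
  ext i
  simp [Matrix.mulVec_mulVec]

/-- The law of `A u`, `u` uniform on the sphere, depends on `A` only through `A A†`. -/
lemma integral_uniformSphere_congr {F : Type*} [NormedAddCommGroup F] [NormedSpace ℝ F]
    {A B : Matrix (Fin d) (Fin d) 𝕜} (hB : IsUnit B.det) (h : A * Aᴴ = B * Bᴴ)
    (f : EuclideanSpace 𝕜 (Fin d) → F) :
    ∫ u, f (Matrix.toEuclideanLin A (u : EuclideanSpace 𝕜 (Fin d))) ∂(uniformSphere 𝕜 d) =
      ∫ u, f (Matrix.toEuclideanLin B (u : EuclideanSpace 𝕜 (Fin d))) ∂(uniformSphere 𝕜 d) := by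
  -- `A` is `B` times a unitary matrix, which the invariance of the uniform law absorbs.
  have hU' : (B⁻¹ * A) * (B⁻¹ * A)ᴴ = 1 := by
    have hB' : IsUnit Bᴴ.det := by rw [det_conjTranspose]; exact hB.star
    rw [conjTranspose_mul, Matrix.mul_assoc, ← Matrix.mul_assoc A, h, conjTranspose_nonsing_inv,
      Matrix.mul_assoc B, Matrix.mul_nonsing_inv _ hB', Matrix.mul_one,
      Matrix.nonsing_inv_mul _ hB]
  have hU : (B⁻¹ * A)ᴴ * (B⁻¹ * A) = 1 := mul_eq_one_comm.1 hU'
  have hA : A = B * (B⁻¹ * A) := by rw [← Matrix.mul_assoc, Matrix.mul_nonsing_inv _ hB,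
    Matrix.one_mul]
  have key := (measurePreserving_uniformSphere (unitaryIsometry _ hU)).integral_comp
    (sphereHomeomorph _).measurableEmbedding
    (fun u => f (Matrix.toEuclideanLin B (u : EuclideanSpace 𝕜 (Fin d))))
  rw [← key]
  refine integral_congr_ae (.of_forall fun u => ?_)
  show f _ = f _
  rw [coe_sphereHomeomorph, unitaryIsometry_apply, ← toEuclideanLin_mul, ← hA]

lemma measurable_normalize : Measurable (NormedSpace.normalize (V := EuclideanSpace 𝕜 (Fin d))) :=
  measurable_norm.inv.smul measurable_id

lemma measurable_angularMap (A : Matrix (Fin d) (Fin d) 𝕜) :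
    Measurable (fun u : Metric.sphere (0 : EuclideanSpace 𝕜 (Fin d)) 1 =>
      NormedSpace.normalize (Matrix.toEuclideanLin A (u : EuclideanSpace 𝕜 (Fin d)))) :=
  measurable_normalize.comp
    ((LinearMap.continuous_of_finiteDimensional _).measurable.comp measurable_subtype_coe)

lemma isProbabilityMeasure_angularLaw (hd : 0 < d) (R : Matrix (Fin d) (Fin d) 𝕜) :
    IsProbabilityMeasure (angularLaw R) := by
  have := isProbabilityMeasure_uniformSphere (𝕜 := 𝕜) hd
  exact Measure.isProbabilityMeasure_map (measurable_angularMap _).aemeasurable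

lemma toEuclideanLin_ne_zero {A : Matrix (Fin d) (Fin d) 𝕜} (hA : IsUnit A.det)
    {x : EuclideanSpace 𝕜 (Fin d)} (hx : x ≠ 0) : Matrix.toEuclideanLin A x ≠ 0 := by
  intro h
  apply hx
  have := toEuclideanLin_mul A⁻¹ A x
  rw [h, Matrix.nonsing_inv_mul _ hA, map_zero] at this
  rw [← this]
  ext i
  simp

lemma ae_norm_angularLaw {R : Matrix (Fin d) (Fin d) 𝕜} (hR : R.PosDef) :
    ∀ᵐ x ∂(angularLaw R), ‖x‖ = 1 := by
  rw [angularLaw, ae_map_iff (measurable_angularMap _).aemeasurable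
    (measurableSet_eq_fun measurable_norm measurable_const)]
  refine .of_forall fun u => NormedSpace.norm_normalize_eq_one_iff.2 ?_
  exact toEuclideanLin_ne_zero (isUnit_det_sqrt hR) (ne_zero_of_mem_unit_sphere u)

/-- The normalised sample covariance `x x† / (x† R⁻¹ x)`. -/
def scatter (R : Matrix (Fin d) (Fin d) 𝕜) (x : EuclideanSpace 𝕜 (Fin d)) :
    Matrix (Fin d) (Fin d) 𝕜 :=
  (quad R x)⁻¹ • Matrix.vecMulVec (fun i => x i) (star fun i => x i)

lemma scatter_apply (R : Matrix (Fin d) (Fin d) 𝕜) (x : EuclideanSpace 𝕜 (Fin d)) (i j : Fin d) :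
    scatter R x i j = (((quad R x)⁻¹ : ℝ) : 𝕜) * (x i * star (x j)) := by
  simp [scatter, vecMulVec_apply, RCLike.real_smul_eq_coe_mul]

lemma quad_smul (R : Matrix (Fin d) (Fin d) 𝕜) (r : ℝ) (x : EuclideanSpace 𝕜 (Fin d)) :
    quad R (r • x) = r ^ 2 * quad R x := by
  have : (fun i => (r • x) i) = r • fun i => x i := rfl
  rw [quad, this, star_smul, mulVec_smul, smul_dotProduct, dotProduct_smul]
  simp [quad, RCLike.smul_re, sq, mul_assoc]

/-- Homogeneity of degree 0 allows the normalisation in `angularLaw` to be dropped under the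
integral. -/
lemma scatter_smul (R : Matrix (Fin d) (Fin d) 𝕜) {r : ℝ} (hr : r ≠ 0)
    (x : EuclideanSpace 𝕜 (Fin d)) : scatter R (r • x) = scatter R x := by
  ext i j
  rw [scatter_apply, scatter_apply, quad_smul]
  have hr' : (r : 𝕜) ≠ 0 := by exact_mod_cast hr
  simp only [PiLp.smul_apply, RCLike.real_smul_eq_coe_mul, star_mul', RCLike.star_def,
    RCLike.conj_ofReal, mul_inv, RCLike.ofReal_mul, RCLike.ofReal_inv, RCLike.ofReal_pow]
  field_simp

lemma scatter_normalize (R : Matrix (Fin d) (Fin d) 𝕜) {x : EuclideanSpace 𝕜 (Fin d)}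
    (hx : x ≠ 0) : scatter R (NormedSpace.normalize x) = scatter R x :=
  scatter_smul R (inv_ne_zero (norm_ne_zero_iff.2 hx)) x

lemma continuous_quad (R : Matrix (Fin d) (Fin d) 𝕜) : Continuous (quad R) := by
  unfold quad dotProduct mulVec dotProduct
  fun_prop

lemma measurable_scatter (R : Matrix (Fin d) (Fin d) 𝕜) (i j : Fin d) :
    Measurable (fun x => scatter R x i j) := by
  simp only [scatter_apply]
  have h : Measurable (fun x => (((quad R x)⁻¹ : ℝ) : 𝕜)) :=
    RCLike.measurable_ofReal.comp (continuous_quad R).measurable.inv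
  refine h.mul (Continuous.measurable ?_)
  fun_prop

lemma quad_one (x : EuclideanSpace 𝕜 (Fin d)) :
    quad (1 : Matrix (Fin d) (Fin d) 𝕜) x = ‖x‖ ^ 2 := by
  rw [quad, inv_one, one_mulVec, EuclideanSpace.norm_sq_eq, dotProduct, map_sum]
  refine Finset.sum_congr rfl fun i _ => ?_
  simp [RCLike.conj_mul]

lemma quad_pos {R : Matrix (Fin d) (Fin d) 𝕜} (hR : R.PosDef) {x : EuclideanSpace 𝕜 (Fin d)}
    (hx : x ≠ 0) : 0 < quad R x :=
  hR.inv.re_dotProduct_pos (x := fun i => x i) fun h => hx (by ext i; exact congrFun h i)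

/-- Change of variables in the quadratic form. -/
lemma quad_toEuclideanLin {A R : Matrix (Fin d) (Fin d) 𝕜} (hA : IsUnit A.det)
    (x : EuclideanSpace 𝕜 (Fin d)) :
    quad (A * R * Aᴴ) (Matrix.toEuclideanLin A x) = quad R x := by
  have hA' : IsUnit Aᴴ.det := by rw [det_conjTranspose]; exact hA.star
  have h1 : (fun i => Matrix.toEuclideanLin A x i) = A *ᵥ fun i => x i := rfl
  rw [quad, h1, star_mulVec, ← dotProduct_mulVec, mulVec_mulVec, mulVec_mulVec, Matrix.mul_inv_rev,
    Matrix.mul_inv_rev, ← Matrix.mul_assoc Aᴴ, Matrix.mul_nonsing_inv _ hA', Matrix.one_mul,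
    Matrix.mul_assoc, Matrix.nonsing_inv_mul _ hA, Matrix.mul_one]
  rfl

lemma scatter_toEuclideanLin {A R : Matrix (Fin d) (Fin d) 𝕜} (hA : IsUnit A.det)
    (x : EuclideanSpace 𝕜 (Fin d)) :
    scatter (A * R * Aᴴ) (Matrix.toEuclideanLin A x) = A * scatter R x * Aᴴ := by
  have h1 : (fun i => Matrix.toEuclideanLin A x i) = A *ᵥ fun i => x i := rfl
  rw [scatter, quad_toEuclideanLin hA, scatter, h1, star_mulVec, Matrix.mul_smul, Matrix.smul_mul,
    mul_vecMulVec, vecMulVec_mul]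

/-- The mean of the normalised sample covariance `x x† / (x† R⁻¹ x)` under the law `s^{R₀}`. -/
def meanScatter (R₀ R : Matrix (Fin d) (Fin d) 𝕜) : Matrix (Fin d) (Fin d) 𝕜 :=
  Matrix.of fun i j => ∫ x, scatter R x i j ∂(angularLaw R₀)

lemma anscm_eq_meanScatter (S : Matrix (Fin d) (Fin d) 𝕜) : anscm S = meanScatter S 1 := by
  ext i j
  simp only [anscm, meanScatter, of_apply, scatter_apply, quad_one]
  congr 1
  ext x
  simp [div_eq_inv_mul]

lemma meanScatter_apply {R₀ : Matrix (Fin d) (Fin d) 𝕜} (hR₀ : R₀.PosDef)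
    (R : Matrix (Fin d) (Fin d) 𝕜) (i j : Fin d) :
    meanScatter R₀ R i j = ∫ u, scatter R (Matrix.toEuclideanLin (CFC.sqrt R₀)
      (u : EuclideanSpace 𝕜 (Fin d))) i j ∂(uniformSphere 𝕜 d) := by
  rw [meanScatter, of_apply, angularLaw, integral_map (measurable_angularMap _).aemeasurable
    (measurable_scatter R i j).aestronglyMeasurable]
  refine integral_congr_ae (.of_forall fun u => ?_)
  show scatter R _ i j = _
  rw [scatter_normalize]
  exact toEuclideanLin_ne_zero (isUnit_det_sqrt hR₀) (ne_zero_of_mem_unit_sphere u)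

lemma exists_quad_lower_bound {R : Matrix (Fin d) (Fin d) 𝕜} (hR : R.PosDef) :
    ∃ m > 0, ∀ x : EuclideanSpace 𝕜 (Fin d), ‖x‖ = 1 → m ≤ quad R x := by
  have hc : IsCompact (Metric.sphere (0 : EuclideanSpace 𝕜 (Fin d)) 1) := isCompact_sphere _ _
  rcases (Metric.sphere (0 : EuclideanSpace 𝕜 (Fin d)) 1).eq_empty_or_nonempty with h | h
  · refine ⟨1, one_pos, fun x hx => ?_⟩
    have : x ∈ Metric.sphere (0 : EuclideanSpace 𝕜 (Fin d)) 1 := by simpa using hx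
    rw [h] at this
    exact this.elim
  · obtain ⟨y, hy, hmin⟩ := hc.exists_isMinOn h (continuous_quad R).continuousOn
    exact ⟨quad R y, quad_pos hR (ne_zero_of_mem_unit_sphere ⟨y, hy⟩), fun x hx =>
      hmin (by simpa using hx)⟩

lemma exists_norm_scatter_le {R : Matrix (Fin d) (Fin d) 𝕜} (hR : R.PosDef) :
    ∃ C, ∀ x : EuclideanSpace 𝕜 (Fin d), x ≠ 0 → ∀ i j, ‖scatter R x i j‖ ≤ C := by
  obtain ⟨m, hm, h⟩ := exists_quad_lower_bound hR
  refine ⟨m⁻¹, fun x hx i j => ?_⟩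
  rw [← scatter_normalize R hx, scatter_apply]
  have hn : ‖NormedSpace.normalize x‖ = 1 := NormedSpace.norm_normalize_eq_one_iff.2 hx
  set y := NormedSpace.normalize x
  have hi : ∀ i, ‖y i‖ ≤ 1 := fun i => hn ▸ PiLp.norm_apply_le y i
  have hq : 0 < quad R y := hm.trans_le (h y hn)
  rw [norm_mul, norm_mul, norm_star, RCLike.norm_ofReal, abs_of_pos (inv_pos.2 hq)]
  have h1 : (quad R y)⁻¹ ≤ m⁻¹ := inv_anti₀ hm (h y hn)
  have h2 : ‖y i‖ * ‖y j‖ ≤ 1 := mul_le_one₀ (hi i) (norm_nonneg _) (hi j)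
  calc _ ≤ m⁻¹ * 1 := mul_le_mul h1 h2 (by positivity) (by positivity)
    _ = m⁻¹ := mul_one _

lemma integrable_scatter {R₀ R : Matrix (Fin d) (Fin d) 𝕜} (hd : 0 < d) (hR₀ : R₀.PosDef)
    (hR : R.PosDef) (i j : Fin d) : Integrable (fun x => scatter R x i j) (angularLaw R₀) := by
  have := isProbabilityMeasure_angularLaw hd R₀
  obtain ⟨C, hC⟩ := exists_norm_scatter_le hR
  refine Integrable.of_bound (measurable_scatter R i j).aestronglyMeasurable C ?_
  filter_upwards [ae_norm_angularLaw hR₀] with x hx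
  exact hC x (by rintro rfl; simp at hx) i j

lemma mul_meanScatter_mul {R₀ R : Matrix (Fin d) (Fin d) 𝕜} (hd : 0 < d) (hR₀ : R₀.PosDef)
    (hR : R.PosDef) (A B : Matrix (Fin d) (Fin d) 𝕜) (i j : Fin d) :
    (A * meanScatter R₀ R * B) i j = ∫ x, (A * scatter R x * B) i j ∂(angularLaw R₀) := by
  simp only [mul_apply, meanScatter, of_apply, Finset.sum_mul]
  have hint : ∀ k l, Integrable (fun x => A i l * scatter R x l k * B k j) (angularLaw R₀) :=
    fun k l => ((integrable_scatter hd hR₀ hR l k).const_mul _).mul_const _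
  rw [integral_finsetSum _ fun k _ => integrable_finsetSum _ fun l _ => hint k l]
  refine Finset.sum_congr rfl fun k _ => ?_
  rw [integral_finsetSum _ fun l _ => hint k l]
  refine Finset.sum_congr rfl fun l _ => ?_
  rw [integral_mul_const, integral_const_mul]

/-- The prior term of the fixed-point equation is a mean under the prior law. -/
lemma sqrt_mul_anscm_mul_sqrt {R₀ R : Matrix (Fin d) (Fin d) 𝕜} (hd : 0 < d) (hR₀ : R₀.PosDef)
    (hR : R.PosDef) :
    CFC.sqrt R * anscm ((CFC.sqrt R)⁻¹ * R₀ * (CFC.sqrt R)⁻¹) * CFC.sqrt R = meanScatter R₀ R := by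
  set T := CFC.sqrt R with hT
  have hTu : IsUnit T.det := isUnit_det_sqrt hR
  have hTh : Tᴴ = T := sqrt_isHermitian R
  have hTT : T * T = R := sqrt_mul_sqrt hR.posSemidef
  have hTih : (T⁻¹)ᴴ = T⁻¹ := by rw [conjTranspose_nonsing_inv, hTh]
  have hTiu : IsUnit (T⁻¹).det := (isUnit_nonsing_inv_det_iff).2 hTu
  have hS : (T⁻¹ * R₀ * T⁻¹).PosDef := by
    have := hR₀.mul_mul_conjTranspose_same (B := T⁻¹)
      (vecMul_injective_of_isUnit ((isUnit_iff_isUnit_det _).2 hTiu))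
    rwa [hTih] at this
  set S := T⁻¹ * R₀ * T⁻¹ with hSdef
  ext i j
  rw [anscm_eq_meanScatter, mul_meanScatter_mul hd hS PosDef.one,
    meanScatter_apply hR₀ R]
  have hm : Measurable fun x : EuclideanSpace 𝕜 (Fin d) => (T * scatter 1 x * T) i j := by
    simp only [mul_apply]
    exact Finset.measurable_sum _ fun k _ => (Finset.measurable_sum _ fun l _ =>
      (measurable_scatter 1 l k).const_mul _).mul_const _
  rw [angularLaw, integral_map (measurable_angularMap _).aemeasurable hm.aestronglyMeasurable]
  have h1 : ∀ u : Metric.sphere (0 : EuclideanSpace 𝕜 (Fin d)) 1,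
      (T * scatter 1 (NormedSpace.normalize (Matrix.toEuclideanLin (CFC.sqrt S)
        (u : EuclideanSpace 𝕜 (Fin d)))) * T) i j =
      (T * scatter 1 (Matrix.toEuclideanLin (CFC.sqrt S)
        (u : EuclideanSpace 𝕜 (Fin d))) * T) i j := fun u => by
    rw [scatter_normalize]
    exact toEuclideanLin_ne_zero (isUnit_det_sqrt hS) (ne_zero_of_mem_unit_sphere u)
  simp only [h1]
  have hWu : IsUnit (T⁻¹ * CFC.sqrt R₀).det := by
    rw [det_mul]; exact hTiu.mul (isUnit_det_sqrt hR₀)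
  -- `S^{1/2}` and `T⁻¹ R₀^{1/2}` need not be equal, but each times its adjoint is `S`. The second
  -- cancels against the conjugation by `T`.
  rw [integral_uniformSphere_congr (B := T⁻¹ * CFC.sqrt R₀) hWu _
    (fun x => (T * scatter 1 x * T) i j)]
  · refine integral_congr_ae (.of_forall fun u => ?_)
    have h2 := scatter_toEuclideanLin (R := 1) hTu (Matrix.toEuclideanLin (T⁻¹ * CFC.sqrt R₀)
      (u : EuclideanSpace 𝕜 (Fin d)))
    rw [hTh, Matrix.mul_one, hTT, ← toEuclideanLin_mul, ← Matrix.mul_assoc,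
      Matrix.mul_nonsing_inv _ hTu, Matrix.one_mul] at h2
    exact (congrFun (congrFun h2 i) j).symm
  · rw [sqrt_isHermitian, sqrt_mul_sqrt hS.posSemidef, conjTranspose_mul, hTih, sqrt_isHermitian,
      Matrix.mul_assoc, ← Matrix.mul_assoc (CFC.sqrt R₀), sqrt_mul_sqrt hR₀.posSemidef, hSdef,
      Matrix.mul_assoc]

end Prior

/-! ### Derivatives of the determinant and of the inverse along a curve. -/

section MatrixCalculus

variable {𝕜 : Type*} [RCLike 𝕜] {d : ℕ}

-- The norm is auxiliary: the results used later are stated entrywise and do not depend on it.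
attribute [local instance] Matrix.linftyOpNormedRing Matrix.linftyOpNormedAlgebra

lemma hasDerivAt_matrix_of_entries {γ : ℝ → Matrix (Fin d) (Fin d) 𝕜}
    {V : Matrix (Fin d) (Fin d) 𝕜} {t : ℝ} (h : ∀ i j, HasDerivAt (fun t => γ t i j) (V i j) t) :
    HasDerivAt γ V t := by
  have h1 : γ = fun t => ∑ i, ∑ j, γ t i j • Matrix.single i j (1 : 𝕜) := by
    ext1 t
    conv_lhs => rw [matrix_eq_sum_single (γ t)]
    simp
  have h2 : V = ∑ i, ∑ j, V i j • Matrix.single i j (1 : 𝕜) := by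
    conv_lhs => rw [matrix_eq_sum_single V]
    simp
  rw [h1, h2]
  refine HasDerivAt.fun_sum fun i _ => HasDerivAt.fun_sum fun j _ => ?_
  exact (h i j).smul_const _

lemma hasFDerivAt_entry (M : Matrix (Fin d) (Fin d) 𝕜) (i j : Fin d) :
    HasFDerivAt (fun A : Matrix (Fin d) (Fin d) 𝕜 => A i j)
      (LinearMap.toContinuousLinearMap (Matrix.entryLinearMap 𝕜 𝕜 i j)) M :=
  (LinearMap.toContinuousLinearMap (Matrix.entryLinearMap 𝕜 𝕜 i j)).hasFDerivAt

lemma hasDerivAt_entry_of_matrix {γ : ℝ → Matrix (Fin d) (Fin d) 𝕜}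
    {V : Matrix (Fin d) (Fin d) 𝕜} {t : ℝ} (h : HasDerivAt γ V t) (i j : Fin d) :
    HasDerivAt (fun t => γ t i j) (V i j) t :=
  ((hasFDerivAt_entry (γ t) i j).restrictScalars ℝ).comp_hasDerivAt t h

lemma differentiableAt_det (M : Matrix (Fin d) (Fin d) 𝕜) :
    DifferentiableAt 𝕜 (fun A : Matrix (Fin d) (Fin d) 𝕜 => A.det) M := by
  simp only [det_apply]
  refine DifferentiableAt.fun_sum fun σ _ => DifferentiableAt.const_smul ?_ _
  exact (HasFDerivAt.finsetProd (g := fun i (A : Matrix (Fin d) (Fin d) 𝕜) => A (σ i) i)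
    fun i _ => hasFDerivAt_entry M (σ i) i).differentiableAt

/-- Factor out `det R`: the polynomial `det (1 + r R⁻¹ V)` has linear coefficient `tr (R⁻¹ V)`, and
the rest is `r ^ 2` times a polynomial. -/
lemma hasDerivAt_det_add_smul {R : Matrix (Fin d) (Fin d) 𝕜} (hR : IsUnit R.det)
    (V : Matrix (Fin d) (Fin d) 𝕜) :
    HasDerivAt (fun r : 𝕜 => (R + r • V).det) (R.det * (R⁻¹ * V).trace) 0 := by
  have h1 : (fun r : 𝕜 => (R + r • V).det) = fun r => R.det * (1 + (R⁻¹ * V).trace * r +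
      (det (1 + (Polynomial.X : Polynomial 𝕜) • (R⁻¹ * V).map Polynomial.C)).divX.divX.eval r
        * r ^ 2) := by
    ext r
    rw [← det_one_add_smul, ← det_mul, Matrix.mul_add, Matrix.mul_one, Matrix.mul_smul,
      ← Matrix.mul_assoc, Matrix.mul_nonsing_inv _ hR, Matrix.one_mul]
  rw [h1]
  set p := (det (1 + (Polynomial.X : Polynomial 𝕜) • (R⁻¹ * V).map Polynomial.C)).divX.divX
  refine HasDerivAt.const_mul _ ?_
  have h2 := ((hasDerivAt_id' (0 : 𝕜)).const_mul (R⁻¹ * V).trace).const_add (1 : 𝕜)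
  have h3 := (p.hasDerivAt (0 : 𝕜)).fun_mul (hasDerivAt_pow 2 (0 : 𝕜))
  exact (h2.fun_add h3).congr_deriv (by simp)

/-- Jacobi's formula. The determinant is differentiable, so its differential at `V` can be read off
along the affine line with direction `V`. -/
lemma hasDerivAt_det {γ : ℝ → Matrix (Fin d) (Fin d) 𝕜} {V : Matrix (Fin d) (Fin d) 𝕜}
    (h : ∀ i j, HasDerivAt (fun t => γ t i j) (V i j) 0) (hR : IsUnit (γ 0).det) :
    HasDerivAt (fun t => (γ t).det) ((γ 0).det * ((γ 0)⁻¹ * V).trace) 0 := by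
  have hL := (differentiableAt_det (γ 0)).hasFDerivAt
  set L := fderiv 𝕜 (fun A : Matrix (Fin d) (Fin d) 𝕜 => A.det) (γ 0)
  have h1 : HasDerivAt (fun r : 𝕜 => γ 0 + r • V) V 0 := by
    have := ((hasDerivAt_id' (0 : 𝕜)).smul_const V).const_add (γ 0)
    rwa [one_smul] at this
  have h2 : HasDerivAt (fun r : 𝕜 => (γ 0 + r • V).det) (L V) 0 :=
    HasFDerivAt.comp_hasDerivAt_of_eq (0 : 𝕜) (l := fun A : Matrix (Fin d) (Fin d) 𝕜 => A.det)
      hL h1 (by simp)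
  rw [(hasDerivAt_det_add_smul hR V).unique h2]
  exact (hL.restrictScalars ℝ).comp_hasDerivAt (0 : ℝ) (hasDerivAt_matrix_of_entries h)

lemma hasDerivAt_inv_entry {γ : ℝ → Matrix (Fin d) (Fin d) 𝕜} {V : Matrix (Fin d) (Fin d) 𝕜}
    (h : ∀ i j, HasDerivAt (fun t => γ t i j) (V i j) 0) (hR : IsUnit (γ 0).det) (i j : Fin d) :
    HasDerivAt (fun t => (γ t)⁻¹ i j) (-((γ 0)⁻¹ * V * (γ 0)⁻¹) i j) 0 := by
  have : CompleteSpace (Matrix (Fin d) (Fin d) 𝕜) := FiniteDimensional.complete 𝕜 _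
  have hu : IsUnit (γ 0) := (isUnit_iff_isUnit_det _).2 hR
  obtain ⟨u, hu⟩ := hu
  have h1 := hasFDerivAt_ringInverse (𝕜 := ℝ) u
  have h2 := HasFDerivAt.comp_hasDerivAt_of_eq (0 : ℝ) h1 (hasDerivAt_matrix_of_entries h) hu
  have h3 := hasDerivAt_entry_of_matrix h2 i j
  have h4 : (↑u⁻¹ : Matrix (Fin d) (Fin d) 𝕜) = (γ 0)⁻¹ := by
    rw [← hu, Matrix.coe_units_inv]
  rw [h4] at h3
  simp only [nonsing_inv_eq_ringInverse] at h3 ⊢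
  exact h3

end MatrixCalculus

/-! ### Differentiation of the likelihood along a curve. -/

section LikelihoodDerivative

variable {𝕜 : Type*} [RCLike 𝕜] {d : ℕ}

lemma quad_eq_sum (R : Matrix (Fin d) (Fin d) 𝕜) (x : EuclideanSpace 𝕜 (Fin d)) :
    quad R x = RCLike.re (∑ i, ∑ j, star (x i) * (R⁻¹ i j * x j)) := by
  simp [quad, dotProduct, mulVec, Finset.mul_sum]

lemma hasDerivAt_quad {γ : ℝ → Matrix (Fin d) (Fin d) 𝕜} {V : Matrix (Fin d) (Fin d) 𝕜}
    (h : ∀ i j, HasDerivAt (fun t => γ t i j) (V i j) 0) (hR : IsUnit (γ 0).det)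
    (x : EuclideanSpace 𝕜 (Fin d)) :
    HasDerivAt (fun t => quad (γ t) x) (-RCLike.re ((γ 0)⁻¹ * V * (γ 0)⁻¹ *
      Matrix.vecMulVec (fun i => x i) (star fun i => x i)).trace) 0 := by
  simp only [quad_eq_sum]
  have h1 := (RCLike.reCLM (K := 𝕜)).hasFDerivAt.comp_hasDerivAt (0 : ℝ)
    (HasDerivAt.fun_sum (u := Finset.univ) fun i _ => HasDerivAt.fun_sum (u := Finset.univ)
      fun j _ => ((hasDerivAt_inv_entry h hR i j).mul_const (x j)).const_mul (star (x i)))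
  refine h1.congr_deriv ?_
  rw [RCLike.reCLM_apply, ← map_neg]
  congr 1
  rw [Matrix.mul_vecMulVec, Matrix.trace_vecMulVec]
  simp only [dotProduct, mulVec, Finset.sum_mul, neg_mul, mul_neg, Finset.sum_neg_distrib]
  congr 1
  refine Finset.sum_congr rfl fun i _ => Finset.sum_congr rfl fun j _ => ?_
  rw [Pi.star_apply]
  ring

lemma hasDerivAt_log_quad {γ : ℝ → Matrix (Fin d) (Fin d) 𝕜} {V : Matrix (Fin d) (Fin d) 𝕜}
    (h : ∀ i j, HasDerivAt (fun t => γ t i j) (V i j) 0) (hR : (γ 0).PosDef)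
    {x : EuclideanSpace 𝕜 (Fin d)} (hx : x ≠ 0) :
    HasDerivAt (fun t => Real.log (quad (γ t) x))
      (-RCLike.re ((γ 0)⁻¹ * V * (γ 0)⁻¹ * scatter (γ 0) x).trace) 0 := by
  refine ((hasDerivAt_quad h hR.det_pos.ne'.isUnit x).log (quad_pos hR hx).ne').congr_deriv ?_
  rw [scatter, Matrix.mul_smul, Matrix.trace_smul, RCLike.smul_re, div_eq_inv_mul, mul_neg]

/-- Along a differentiable curve, `x† γ(t)⁻¹ x` is Lipschitz at `0`, uniformly on the sphere. -/
lemma exists_quad_sub_le {γ : ℝ → Matrix (Fin d) (Fin d) 𝕜} {V : Matrix (Fin d) (Fin d) 𝕜}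
    (h : ∀ i j, HasDerivAt (fun t => γ t i j) (V i j) 0) (hR : IsUnit (γ 0).det) :
    ∃ K, 0 < K ∧ ∀ᶠ t in nhds (0 : ℝ), ∀ x : EuclideanSpace 𝕜 (Fin d), ‖x‖ = 1 →
      |quad (γ t) x - quad (γ 0) x| ≤ K * |t| := by
  have h1 : ∀ i j, ∃ c, ∀ᶠ t in nhds (0 : ℝ), ‖(γ t)⁻¹ i j - (γ 0)⁻¹ i j‖ ≤ c * |t| := by
    intro i j
    obtain ⟨c, hc⟩ := (hasDerivAt_inv_entry h hR i j).isBigO_sub.bound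
    exact ⟨c, by simpa using hc⟩
  choose c hc using h1
  -- The constants `c i j` carry no sign, hence the absolute values; the added 1 makes the bound
  -- strictly positive.
  refine ⟨∑ i, ∑ j, |c i j| + 1, by positivity, ?_⟩
  filter_upwards [Filter.eventually_all.2 fun i => Filter.eventually_all.2 fun j => hc i j]
    with t ht x hx
  have hi : ∀ i, ‖x i‖ ≤ 1 := fun i => hx ▸ PiLp.norm_apply_le x i
  rw [quad_eq_sum, quad_eq_sum, ← map_sub, ← Finset.sum_sub_distrib]
  simp only [← Finset.sum_sub_distrib]
  refine (RCLike.abs_re_le_norm _).trans ?_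
  calc _ ≤ ∑ i, ∑ j, |c i j| * |t| := by
        refine (norm_sum_le _ _).trans (Finset.sum_le_sum fun i _ => ?_)
        refine (norm_sum_le _ _).trans (Finset.sum_le_sum fun j _ => ?_)
        rw [← mul_sub, ← sub_mul, norm_mul, norm_mul, norm_star]
        have h2 := (ht i j).trans (mul_le_mul_of_nonneg_right (le_abs_self (c i j)) (abs_nonneg t))
        calc _ ≤ 1 * (|c i j| * |t| * 1) := by gcongr <;> exact hi _
          _ = _ := by ring
    _ = (∑ i, ∑ j, |c i j|) * |t| := by simp only [Finset.sum_mul]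
    _ ≤ _ := by gcongr; linarith

/-- Apply `log t ≤ t - 1` to `a / b` and to `b / a`. -/
lemma abs_log_sub_log_le {a b m : ℝ} (hm : 0 < m) (ha : m ≤ a) (hb : m ≤ b) :
    |Real.log a - Real.log b| ≤ m⁻¹ * |a - b| := by
  have key : ∀ a b : ℝ, m ≤ a → m ≤ b → Real.log a - Real.log b ≤ m⁻¹ * |a - b| := by
    intro a b ha hb
    have ha0 := hm.trans_le ha
    have hb0 := hm.trans_le hb
    rw [← Real.log_div ha0.ne' hb0.ne']
    calc _ ≤ a / b - 1 := Real.log_le_sub_one_of_pos (by positivity)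
      _ = b⁻¹ * (a - b) := by field_simp
      _ ≤ b⁻¹ * |a - b| := by gcongr; exact le_abs_self _
      _ ≤ _ := by gcongr
  rw [abs_le]
  have h1 := key a b ha hb
  have h2 := key b a hb ha
  rw [abs_sub_comm] at h2
  constructor <;> linarith

lemma integrable_log_quad_div {R₀ R : Matrix (Fin d) (Fin d) 𝕜} (hd : 0 < d) (hR₀ : R₀.PosDef)
    (hR : R.PosDef) : Integrable (fun x => Real.log (quad R x / quad R₀ x)) (angularLaw R₀) := by
  have := isProbabilityMeasure_angularLaw hd R₀
  have hne : ∀ x ∈ Metric.sphere (0 : EuclideanSpace 𝕜 (Fin d)) 1, x ≠ 0 :=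
    fun x hx => ne_zero_of_mem_unit_sphere ⟨x, hx⟩
  have hc : ContinuousOn (fun x => Real.log (quad R x / quad R₀ x))
      (Metric.sphere (0 : EuclideanSpace 𝕜 (Fin d)) 1) :=
    ((continuous_quad R).continuousOn.div (continuous_quad R₀).continuousOn
      fun x hx => (quad_pos hR₀ (hne x hx)).ne').log
      fun x hx => (div_pos (quad_pos hR (hne x hx)) (quad_pos hR₀ (hne x hx))).ne'
  obtain ⟨C, hC⟩ := (isCompact_sphere (0 : EuclideanSpace 𝕜 (Fin d)) 1).exists_bound_of_continuousOn
    hc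
  refine Integrable.of_bound (((continuous_quad R).measurable.div
    (continuous_quad R₀).measurable).log).aestronglyMeasurable C ?_
  filter_upwards [ae_norm_angularLaw hR₀] with x hx
  exact hC x (by simpa using hx)

lemma re_trace_mul_meanScatter {R₀ R : Matrix (Fin d) (Fin d) 𝕜} (hd : 0 < d) (hR₀ : R₀.PosDef)
    (hR : R.PosDef) (A : Matrix (Fin d) (Fin d) 𝕜) :
    RCLike.re (A * meanScatter R₀ R).trace =
      ∫ x, RCLike.re (A * scatter R x).trace ∂(angularLaw R₀) := by
  have hint : ∀ i j, Integrable (fun x => A i j * scatter R x j i) (angularLaw R₀) :=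
    fun i j => (integrable_scatter hd hR₀ hR j i).const_mul _
  have h := integral_re (integrable_finsetSum Finset.univ fun i _ =>
    integrable_finsetSum Finset.univ fun j _ => hint i j)
  simp only [trace, diag, mul_apply]
  rw [h, integral_finsetSum _ fun i _ => integrable_finsetSum _ fun j _ => hint i j]
  congr 1
  refine Finset.sum_congr rfl fun i _ => ?_
  rw [integral_finsetSum _ fun j _ => hint i j]
  refine Finset.sum_congr rfl fun j _ => ?_
  rw [integral_const_mul, meanScatter, of_apply]

/-- The curve is differentiable only at 0, so differentiation under the integral must rest on a
Lipschitz bound at that single point, uniform in `x`. -/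
lemma hasDerivAt_integral_log_quad {R₀ : Matrix (Fin d) (Fin d) 𝕜}
    {γ : ℝ → Matrix (Fin d) (Fin d) 𝕜} {V : Matrix (Fin d) (Fin d) 𝕜} (hd : 0 < d)
    (hR₀ : R₀.PosDef) (h : ∀ i j, HasDerivAt (fun t => γ t i j) (V i j) 0) (hR : (γ 0).PosDef) :
    HasDerivAt (fun t => ∫ x, Real.log (quad (γ t) x / quad R₀ x) ∂(angularLaw R₀))
      (-RCLike.re ((γ 0)⁻¹ * V * (γ 0)⁻¹ * meanScatter R₀ (γ 0)).trace) 0 := by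
  have := isProbabilityMeasure_angularLaw hd R₀
  obtain ⟨K, hK, hlip⟩ := exists_quad_sub_le h hR.det_pos.ne'.isUnit
  obtain ⟨m, hm, hlow⟩ := exists_quad_lower_bound hR
  -- The margin keeps the quadratic form above `m / 2` near 0, where `log` is `(m / 2)⁻¹`-Lipschitz.
  -- This gives the constant dominating function `(m / 2)⁻¹ * K`.
  have hsmall : ∀ᶠ t in nhds (0 : ℝ), K * |t| < m / 2 := by
    have hc : Continuous fun t : ℝ => K * |t| := by fun_prop
    exact hc.continuousAt.eventually_lt continuousAt_const (by simpa using hm)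
  set s := {t : ℝ | (∀ x : EuclideanSpace 𝕜 (Fin d), ‖x‖ = 1 →
      |quad (γ t) x - quad (γ 0) x| ≤ K * |t|) ∧ K * |t| < m / 2} with hs_def
  have hs : s ∈ nhds (0 : ℝ) := hlip.and hsmall
  set f' : EuclideanSpace 𝕜 (Fin d) → ℝ := fun x =>
    -RCLike.re ((γ 0)⁻¹ * V * (γ 0)⁻¹ * scatter (γ 0) x).trace with hf'
  have hf'm : Measurable f' := by
    simp only [hf', trace, diag, mul_apply (N := scatter _ _)]
    exact (RCLike.measurable_re.comp (Finset.measurable_sum _ fun i _ =>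
      Finset.measurable_sum _ fun j _ => (measurable_scatter (γ 0) j i).const_mul _)).neg
  set L : ℝ →L[ℝ] ℝ →L[ℝ] ℝ := ContinuousLinearMap.smulRightL ℝ ℝ ℝ 1
  have hne : ∀ x : EuclideanSpace 𝕜 (Fin d), ‖x‖ = 1 → x ≠ 0 := by
    rintro x hx rfl
    simp at hx
  have main := hasFDerivAt_integral_of_dominated_loc_of_lip' (μ := angularLaw R₀) (𝕜 := ℝ)
    (F := fun t x => Real.log (quad (γ t) x / quad R₀ x)) (x₀ := (0 : ℝ)) (s := s)
    (F' := fun x => L (f' x)) (bound := fun _ => (m / 2)⁻¹ * K) hs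
    (fun t _ => (((continuous_quad (γ t)).measurable.div
      (continuous_quad R₀).measurable).log).aestronglyMeasurable)
    (integrable_log_quad_div hd hR₀ hR)
    (L.continuous.measurable.comp hf'm).aestronglyMeasurable ?_ (integrable_const _) ?_
  · have h1 := main.2.hasDerivAt
    refine h1.congr_deriv ?_
    rw [ContinuousLinearMap.integral_apply main.1, re_trace_mul_meanScatter hd hR₀ hR,
      ← integral_neg]
    simp [L, hf']
  · filter_upwards [ae_norm_angularLaw hR₀] with x hx t ht
    have hx0 := hne x hx
    have hq₀ := quad_pos hR₀ hx0
    have h1 := hlow x hx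
    have h2 := ht.1 x hx
    have h3 : m / 2 ≤ quad (γ t) x := by
      have := (abs_le.1 h2).1
      linarith [ht.2]
    have h4 : m / 2 ≤ quad (γ 0) x := by linarith
    have hm2 : 0 < m / 2 := by linarith
    rw [Real.log_div (hm2.trans_le h3).ne' hq₀.ne', Real.log_div (hm2.trans_le h4).ne' hq₀.ne',
      sub_sub_sub_cancel_right, Real.norm_eq_abs, sub_zero, Real.norm_eq_abs, mul_assoc]
    exact (abs_log_sub_log_le hm2 h3 h4).trans (by gcongr)
  · filter_upwards [ae_norm_angularLaw hR₀] with x hx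
    have hx0 := hne x hx
    have hq₀ := quad_pos hR₀ hx0
    have h1 := ((hasDerivAt_log_quad h hR hx0).sub_const (Real.log (quad R₀ x))).hasFDerivAt
    refine HasFDerivAt.congr_of_eventuallyEq h1 ?_
    filter_upwards [hs] with t ht
    have h2 := ht.1 x hx
    have h3 : 0 < quad (γ t) x := by
      have := (abs_le.1 h2).1
      linarith [ht.2, hlow x hx]
    exact Real.log_div h3.ne' hq₀.ne'

/-- The common form of the two likelihoods. -/
def likelihood {N : ℕ} (a b : ℝ) (R₀ : Matrix (Fin d) (Fin d) 𝕜)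
    (x : Fin N → EuclideanSpace 𝕜 (Fin d)) (R : Matrix (Fin d) (Fin d) 𝕜) : ℝ :=
  -(a / N) * ∑ n, Real.log (quad R (x n))
    - b * ∫ x, Real.log (quad R x / quad R₀ x) ∂(angularLaw R₀)

lemma tylerMap_eq {N : ℕ} {R₀ R : Matrix (Fin d) (Fin d) 𝕜} (hd : 0 < d) (hR₀ : R₀.PosDef)
    (hR : R.PosDef) (β : ℝ) (x : Fin N → EuclideanSpace 𝕜 (Fin d)) :
    tylerMap β R₀ x R = (1 - β) • meanScatter R₀ R + (β / N) • ∑ n, scatter R (x n) := by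
  rw [tylerMap, sqrt_mul_anscm_mul_sqrt hd hR₀ hR]
  rfl

lemma hasDerivAt_likelihood {N : ℕ} {R₀ : Matrix (Fin d) (Fin d) 𝕜}
    {γ : ℝ → Matrix (Fin d) (Fin d) 𝕜} {V : Matrix (Fin d) (Fin d) 𝕜} (hd : 0 < d)
    (hR₀ : R₀.PosDef) (h : ∀ i j, HasDerivAt (fun t => γ t i j) (V i j) 0) (hR : (γ 0).PosDef)
    {x : Fin N → EuclideanSpace 𝕜 (Fin d)} (hx : ∀ n, x n ≠ 0) (s β : ℝ) :
    HasDerivAt (fun t => likelihood (s * β) (s * (1 - β)) R₀ x (γ t))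
      (s * RCLike.re ((γ 0)⁻¹ * V * (γ 0)⁻¹ * tylerMap β R₀ x (γ 0)).trace) 0 := by
  have h1 := (HasDerivAt.fun_sum (u := Finset.univ) fun n _ =>
    hasDerivAt_log_quad h hR (hx n)).const_mul (-(s * β / N))
  have h2 := (hasDerivAt_integral_log_quad hd hR₀ h hR).const_mul (s * (1 - β))
  refine (h1.sub h2).congr_deriv ?_
  rw [tylerMap_eq hd hR₀ hR, Matrix.mul_add, Matrix.mul_smul, Matrix.mul_smul, Matrix.mul_sum,
    trace_add, trace_smul, trace_smul, trace_sum, map_add, RCLike.smul_re, RCLike.smul_re, map_sum,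
    Finset.sum_neg_distrib]
  ring

end LikelihoodDerivative

/-! ### Stationarity under the determinant constraint. -/

section Stationary

variable {𝕜 : Type*} [RCLike 𝕜] {d : ℕ}

lemma scatter_isHermitian (R : Matrix (Fin d) (Fin d) 𝕜) (x : EuclideanSpace 𝕜 (Fin d)) :
    (scatter R x).IsHermitian := by
  ext i j
  simp [scatter_apply, mul_comm]

lemma re_trace_inv_mul_scatter {R : Matrix (Fin d) (Fin d) 𝕜} (hR : R.PosDef)
    {x : EuclideanSpace 𝕜 (Fin d)} (hx : x ≠ 0) :
    RCLike.re (R⁻¹ * scatter R x).trace = 1 := by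
  rw [scatter, Matrix.mul_smul, trace_smul, RCLike.smul_re, mul_vecMulVec, trace_vecMulVec,
    dotProduct_comm]
  exact inv_mul_cancel₀ (quad_pos hR hx).ne'

lemma meanScatter_isHermitian (R₀ R : Matrix (Fin d) (Fin d) 𝕜) :
    (meanScatter R₀ R).IsHermitian := by
  ext i j
  rw [conjTranspose_apply, meanScatter, of_apply, of_apply, RCLike.star_def, ← integral_conj]
  refine integral_congr_ae (.of_forall fun x => ?_)
  exact (scatter_isHermitian R x).apply i j

lemma re_trace_inv_mul_meanScatter {R₀ R : Matrix (Fin d) (Fin d) 𝕜} (hd : 0 < d)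
    (hR₀ : R₀.PosDef) (hR : R.PosDef) : RCLike.re (R⁻¹ * meanScatter R₀ R).trace = 1 := by
  have := isProbabilityMeasure_angularLaw hd R₀
  rw [re_trace_mul_meanScatter hd hR₀ hR]
  have h : (fun x => RCLike.re (R⁻¹ * scatter R x).trace) =ᵐ[angularLaw R₀] fun _ => (1 : ℝ) := by
    filter_upwards [ae_norm_angularLaw hR₀] with x hx
    exact re_trace_inv_mul_scatter hR (by rintro rfl; simp at hx)
  rw [integral_congr_ae h]
  simp

variable {N : ℕ}

lemma tylerMap_isHermitian {R₀ R : Matrix (Fin d) (Fin d) 𝕜} (hd : 0 < d) (hR₀ : R₀.PosDef)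
    (hR : R.PosDef) (β : ℝ) (x : Fin N → EuclideanSpace 𝕜 (Fin d)) :
    (tylerMap β R₀ x R).IsHermitian := by
  rw [tylerMap_eq hd hR₀ hR, IsHermitian, conjTranspose_add, conjTranspose_smul,
    conjTranspose_smul, conjTranspose_sum, (meanScatter_isHermitian R₀ R).eq, star_trivial,
    star_trivial]
  simp only [(scatter_isHermitian R _).eq]

/-- Every scatter matrix has this normalisation, and the weights `1 - β` and `β / N` (taken `N`
times) sum to 1. It determines the proportionality factor. -/
lemma re_trace_inv_mul_tylerMap (hN : 0 < N) {R₀ R : Matrix (Fin d) (Fin d) 𝕜} (hd : 0 < d)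
    (hR₀ : R₀.PosDef) (hR : R.PosDef) (β : ℝ) {x : Fin N → EuclideanSpace 𝕜 (Fin d)}
    (hx : ∀ n, x n ≠ 0) : RCLike.re (R⁻¹ * tylerMap β R₀ x R).trace = 1 := by
  rw [tylerMap_eq hd hR₀ hR, Matrix.mul_add, Matrix.mul_smul, Matrix.mul_smul, Matrix.mul_sum,
    trace_add, trace_smul, trace_smul, trace_sum, map_add, RCLike.smul_re, RCLike.smul_re, map_sum,
    re_trace_inv_mul_meanScatter hd hR₀ hR]
  simp only [re_trace_inv_mul_scatter hR (hx _)]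
  have : (N : ℝ) ≠ 0 := by exact_mod_cast hN.ne'
  simp only [Finset.sum_const, Finset.card_univ, Fintype.card_fin, nsmul_eq_mul]
  field_simp
  ring

/-- Simultaneous diagonalisation of a positive definite and a Hermitian form. -/
lemma exists_simultaneous_diagonalization {R M : Matrix (Fin d) (Fin d) 𝕜} (hR : R.PosDef)
    (hM : M.IsHermitian) : ∃ (B : Matrix (Fin d) (Fin d) 𝕜) (m : Fin d → ℝ), IsUnit B.det ∧
      R = B * Bᴴ ∧ M = B * diagonal (fun i => (m i : 𝕜)) * Bᴴ := by
  have hTu : IsUnit (CFC.sqrt R).det := isUnit_det_sqrt hR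
  have hTh := sqrt_isHermitian R
  have hTT := sqrt_mul_sqrt hR.posSemidef
  set T := CFC.sqrt R
  have hTih : (T⁻¹)ᴴ = T⁻¹ := by rw [conjTranspose_nonsing_inv, hTh]
  have hA : (T⁻¹ * M * T⁻¹).IsHermitian := by
    have := isHermitian_mul_mul_conjTranspose T⁻¹ hM
    rwa [hTih] at this
  set U : Matrix (Fin d) (Fin d) 𝕜 := hA.eigenvectorUnitary.1
  have hUU : U * Uᴴ = 1 := Unitary.coe_mul_star_self hA.eigenvectorUnitary
  have hspec : T⁻¹ * M * T⁻¹ = U * diagonal (fun i => (hA.eigenvalues i : 𝕜)) * Uᴴ :=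
    hA.spectral_theorem
  refine ⟨T * U, hA.eigenvalues, ?_, ?_, ?_⟩
  · rw [det_mul]
    exact hTu.mul (IsUnit.of_mul_eq_one _ (by rw [← det_mul, hUU, det_one]))
  · rw [conjTranspose_mul, hTh, Matrix.mul_assoc, ← Matrix.mul_assoc U, hUU, Matrix.one_mul, hTT]
  · calc M = T * (T⁻¹ * M * T⁻¹) * T := by
          rw [Matrix.mul_assoc T⁻¹, ← Matrix.mul_assoc, Matrix.mul_nonsing_inv _ hTu,
            Matrix.one_mul, Matrix.mul_assoc, Matrix.nonsing_inv_mul _ hTu, Matrix.mul_one]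
      _ = T * (U * diagonal (fun i => (hA.eigenvalues i : 𝕜)) * Uᴴ) * T :=
          congrArg (fun X => T * X * T) hspec
      _ = _ := by rw [conjTranspose_mul, hTh]; simp only [Matrix.mul_assoc]

lemma inv_mul_conj_diagonal {B : Matrix (Fin d) (Fin d) 𝕜} (hB : IsUnit B.det) (v : Fin d → 𝕜) :
    (B * Bᴴ)⁻¹ * (B * diagonal v * Bᴴ) = (Bᴴ)⁻¹ * diagonal v * Bᴴ := by
  rw [Matrix.mul_inv_rev, Matrix.mul_assoc B, Matrix.mul_assoc, ← Matrix.mul_assoc B⁻¹,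
    Matrix.nonsing_inv_mul _ hB, Matrix.one_mul, Matrix.mul_assoc]

lemma trace_inv_mul_conj {B : Matrix (Fin d) (Fin d) 𝕜} (hB : IsUnit B.det)
    (D : Matrix (Fin d) (Fin d) 𝕜) : ((Bᴴ)⁻¹ * D * Bᴴ).trace = D.trace := by
  have hB' : IsUnit Bᴴ.det := by rw [det_conjTranspose]; exact hB.star
  rw [Matrix.mul_assoc, trace_mul_comm, Matrix.mul_assoc, Matrix.mul_nonsing_inv _ hB',
    Matrix.mul_one]

/-- Stationarity forces `tylerMap` to be proportional to `R`: test it along the curve through `R`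
obtained by exponentiating the traceless part of `tylerMap`. -/
lemma eq_inv_card_of_isStationary {R₀ R : Matrix (Fin d) (Fin d) 𝕜} (hd : 0 < d)
    (hR₀ : R₀.PosDef) (hR : R ∈ HP 𝕜 d) {x : Fin N → EuclideanSpace 𝕜 (Fin d)}
    (hx : ∀ n, x n ≠ 0) {s β : ℝ} (hs : 0 < s)
    (hst : IsStationary (likelihood (s * β) (s * (1 - β)) R₀ x) R)
    {B : Matrix (Fin d) (Fin d) 𝕜} {m : Fin d → ℝ} (hB : IsUnit B.det) (hRB : R = B * Bᴴ)
    (hM : tylerMap β R₀ x R = B * diagonal (fun i => (m i : 𝕜)) * Bᴴ) (hm : ∑ i, m i = 1) :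
    ∀ i, m i = (d : ℝ)⁻¹ := by
  have hd0 : (d : ℝ) ≠ 0 := by exact_mod_cast hd.ne'
  set w : Fin d → ℝ := fun i => m i - (d : ℝ)⁻¹ with hw
  have hw0 : ∑ i, w i = 0 := by
    simp [hw, Finset.sum_sub_distrib, hm, hd0]
  -- The weights `w` sum to zero, so the exponentials multiply to 1 and the curve keeps unit
  -- determinant.
  set γ : ℝ → Matrix (Fin d) (Fin d) 𝕜 := fun t =>
    B * diagonal (fun i => ((Real.exp (w i * t) : ℝ) : 𝕜)) * Bᴴ with hγ
  have hγ0 : γ 0 = R := by simp [hγ, hRB]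
  have hBinj : Function.Injective B.vecMul :=
    vecMul_injective_of_isUnit ((isUnit_iff_isUnit_det _).2 hB)
  have hγHP : ∀ t, γ t ∈ HP 𝕜 d := by
    intro t
    refine ⟨PosDef.mul_mul_conjTranspose_same (posDef_diagonal_iff.2 fun i => ?_) hBinj, ?_⟩
    · exact_mod_cast Real.exp_pos _
    · have h1 : (B * Bᴴ).det = 1 := hRB ▸ hR.2
      rw [det_mul] at h1
      rw [hγ, det_mul, det_mul, mul_right_comm, h1, one_mul, det_diagonal, ← RCLike.ofReal_prod,
        ← Real.exp_sum, ← Finset.sum_mul, hw0]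
      simp
  have hderiv : ∀ i j, HasDerivAt (fun t => γ t i j)
      ((B * diagonal (fun i => (w i : 𝕜)) * Bᴴ) i j) 0 := by
    intro i j
    simp only [hγ, mul_apply (N := Bᴴ), mul_diagonal]
    refine HasDerivAt.fun_sum fun k _ => HasDerivAt.mul_const (HasDerivAt.const_mul _ ?_) _
    have h1 : HasDerivAt (fun t => Real.exp (w k * t)) (w k) 0 := by
      simpa using ((hasDerivAt_id' (0 : ℝ)).const_mul (w k)).exp
    exact (RCLike.ofRealCLM (K := 𝕜)).hasFDerivAt.comp_hasDerivAt (0 : ℝ) h1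
  have h1 := hst.2 γ hγ0 (.of_forall hγHP) fun i j => (hderiv i j).differentiableAt
  have h2 := h1.unique (hasDerivAt_likelihood hd hR₀ hderiv (hγ0 ▸ hR.1) hx s β)
  have hB' : IsUnit Bᴴ.det := by rw [det_conjTranspose]; exact hB.star
  rw [hγ0, hM, Matrix.mul_assoc, hRB, inv_mul_conj_diagonal hB, inv_mul_conj_diagonal hB,
    ← Matrix.mul_assoc, ← Matrix.mul_assoc, Matrix.mul_assoc _ Bᴴ, Matrix.mul_nonsing_inv _ hB',
    Matrix.mul_one, Matrix.mul_assoc (Bᴴ)⁻¹, trace_inv_mul_conj hB, diagonal_mul_diagonal,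
    trace_diagonal, map_sum] at h2
  simp only [← RCLike.ofReal_mul, RCLike.ofReal_re] at h2
  have h3 : ∑ i, w i * m i = 0 := by
    rcases mul_eq_zero.1 h2.symm with h | h
    · exact absurd h hs.ne'
    · exact h
  -- As `∑ w i = 0`, subtracting the mean `1 / d` from `m i` does not change `∑ w i * m i`.
  have h4 : ∑ i, w i ^ 2 = 0 := by
    have : ∀ i, w i ^ 2 = w i * m i - w i * (d : ℝ)⁻¹ := fun i => by simp only [hw]; ring
    simp only [this, Finset.sum_sub_distrib, h3, ← Finset.sum_mul, hw0]
    simp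
  intro i
  have h5 := (Finset.sum_eq_zero_iff_of_nonneg fun i _ => sq_nonneg (w i)).1 h4 i
    (Finset.mem_univ i)
  exact sub_eq_zero.1 (pow_eq_zero_iff two_ne_zero |>.1 h5)

lemma re_trace_inv_mul_deriv_eq_zero {γ : ℝ → Matrix (Fin d) (Fin d) 𝕜}
    {V : Matrix (Fin d) (Fin d) 𝕜} (h : ∀ i j, HasDerivAt (fun t => γ t i j) (V i j) 0)
    (h0 : (γ 0).det = 1) (hγ : ∀ᶠ t in nhds 0, γ t ∈ HP 𝕜 d) : ((γ 0)⁻¹ * V).trace = 0 := by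
  have h1 := hasDerivAt_det h (by rw [h0]; exact isUnit_one)
  have h2 : HasDerivAt (fun t => (γ t).det) 0 0 :=
    (hasDerivAt_const (0 : ℝ) (1 : 𝕜)).congr_of_eventuallyEq (hγ.mono fun t ht => ht.2)
  have h3 := h1.unique h2
  rwa [h0, one_mul] at h3

/-- For `d = 1` the weight `s` may vanish and stationarity then says nothing, but the trace
normalisation alone gives the fixed-point equation. -/
theorem isStationary_likelihood_iff (hN : 0 < N) {R₀ R : Matrix (Fin d) (Fin d) 𝕜} (hd : 0 < d)
    (hR₀ : R₀.PosDef) (hR : R ∈ HP 𝕜 d) {x : Fin N → EuclideanSpace 𝕜 (Fin d)}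
    (hx : ∀ n, x n ≠ 0) {s β : ℝ} (hs : 0 < s ∨ d = 1) :
    IsStationary (likelihood (s * β) (s * (1 - β)) R₀ x) R ↔
      ∃ c : ℝ, 0 < c ∧ R = c • tylerMap β R₀ x R := by
  have hdpos : (0 : ℝ) < d := by exact_mod_cast hd
  constructor
  · intro hst
    obtain ⟨B, m, hB, hRB, hM⟩ :=
      exists_simultaneous_diagonalization hR.1 (tylerMap_isHermitian hd hR₀ hR.1 β x)
    have hm : ∑ i, m i = 1 := by
      have h1 := re_trace_inv_mul_tylerMap hN hd hR₀ hR.1 β hx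
      rw [hM] at h1
      nth_rewrite 1 [hRB] at h1
      rw [inv_mul_conj_diagonal hB, trace_inv_mul_conj hB, trace_diagonal, map_sum] at h1
      simpa using h1
    have hmi : ∀ i, m i = (d : ℝ)⁻¹ := by
      rcases hs with hs | rfl
      · exact eq_inv_card_of_isStationary hd hR₀ hR hx hs hst hB hRB hM hm
      · intro i
        rw [Fin.sum_univ_one] at hm
        rw [Subsingleton.elim i 0, hm]
        simp
    -- The factor is forced: `tr (R⁻¹ R) = d` while `re tr (R⁻¹ M) = 1`.
    refine ⟨d, hdpos, ?_⟩
    have h2 : diagonal (fun i => (m i : 𝕜)) = (d : ℝ)⁻¹ • (1 : Matrix (Fin d) (Fin d) 𝕜) := by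
      ext i j
      by_cases hij : i = j
      · subst hij; simp [hmi, RCLike.real_smul_eq_coe_mul]
      · simp [hij]
    rw [hM, h2, Matrix.mul_smul, Matrix.smul_mul, Matrix.mul_one, smul_smul,
      mul_inv_cancel₀ hdpos.ne', one_smul, ← hRB]
  · rintro ⟨c, hc, hRc⟩
    refine ⟨hR, fun γ hγ0 hγ hdiff => ?_⟩
    have h : ∀ i j, HasDerivAt (fun t => γ t i j)
        (Matrix.of (fun i j => deriv (fun t => γ t i j) 0) i j) 0 :=
      fun i j => (hdiff i j).hasDerivAt
    have h0 := re_trace_inv_mul_deriv_eq_zero h (hγ0 ▸ hR.2) hγ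
    refine (hasDerivAt_likelihood hd hR₀ h (hγ0 ▸ hR.1) hx s β).congr_deriv ?_
    have hM : tylerMap β R₀ x (γ 0) = c⁻¹ • γ 0 := by
      rw [hγ0]
      nth_rewrite 2 [hRc]
      rw [smul_smul, inv_mul_cancel₀ hc.ne', one_smul]
    have hu : IsUnit (γ 0).det := by rw [hγ0, hR.2]; exact isUnit_one
    rw [hM, Matrix.mul_smul, Matrix.mul_assoc, Matrix.nonsing_inv_mul _ hu, Matrix.mul_one,
      trace_smul, h0]
    simp

end Stationary

/-! ### Reduction of the real and complex likelihoods to the common form. -/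

lemma realLikelihood_eq {d N : ℕ} (α : ℝ) (R₀ : Matrix (Fin d) (Fin d) ℝ)
    (x : Fin N → EuclideanSpace ℝ (Fin d)) :
    realLikelihood α R₀ x =
      likelihood (((d : ℝ) - 1) / 2 * α) (((d : ℝ) - 1) / 2 * (1 - α)) R₀ x := by
  ext R
  rw [realLikelihood, likelihood, angularEntropy, Module.finrank_self]
  push_cast
  ring

/-- The samples weigh `α (d - 1)` and the prior `(1 - α) (d - 1/2)`. The total is `d - (1 + α) / 2`,
and the share of the samples is `α'`. -/
lemma complexLikelihood_eq {d N : ℕ} (hd : 0 < d) {α : ℝ} (hα : α ≤ 1)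
    (R₀ : Matrix (Fin d) (Fin d) ℂ) (x : Fin N → EuclideanSpace ℂ (Fin d)) :
    complexLikelihood α R₀ x =
      likelihood ((d - (1 + α) / 2) * (α * (d - 1) / (d - (1 + α) / 2)))
        ((d - (1 + α) / 2) * (1 - α * (d - 1) / (d - (1 + α) / 2))) R₀ x := by
  have hd1 : (1 : ℝ) ≤ d := by exact_mod_cast hd
  have h1 : ((d : ℝ) - (1 + α) / 2) * (α * (d - 1) / (d - (1 + α) / 2)) = α * (d - 1) := by
    -- A zero denominator forces `d = 1`, where the numerator vanishes too; division by zero then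
    -- yields `α' = 0`.
    refine mul_div_cancel_of_imp' fun h => ?_
    have : (d : ℝ) = 1 := by linarith
    rw [this]
    ring
  ext R
  rw [complexLikelihood, likelihood, angularEntropy, Complex.finrank_real_complex,
    mul_sub (_ - _) 1, h1]
  push_cast
  ring

end RegTyler

end

theorem mainTheorem3 (d N : ℕ) (hN : 0 < N) (α : ℝ) (hα : α ∈ Set.Icc (0 : ℝ) 1) :
    -- real case
    (∀ (Rprior : Matrix (Fin d) (Fin d) ℝ) (x : Fin N → EuclideanSpace ℝ (Fin d)),
      Rprior ∈ RegTyler.HP ℝ d → (∀ n, x n ≠ 0) → ∀ R ∈ RegTyler.HP ℝ d,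
        (RegTyler.IsStationary (RegTyler.realLikelihood α Rprior x) R ↔
          ∃ c : ℝ, 0 < c ∧ R = c • RegTyler.tylerMap α Rprior x R)) ∧
    -- complex circular case
    (∀ (Rprior : Matrix (Fin d) (Fin d) ℂ) (x : Fin N → EuclideanSpace ℂ (Fin d)),
      Rprior ∈ RegTyler.HP ℂ d → (∀ n, x n ≠ 0) → ∀ R ∈ RegTyler.HP ℂ d,
        (RegTyler.IsStationary (RegTyler.complexLikelihood α Rprior x) R ↔
          ∃ c : ℝ, 0 < c ∧
            R = c • RegTyler.tylerMap (α * (d - 1) / (d - (1 + α) / 2)) Rprior x R)) := by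
  constructor
  · intro R₀ x hR₀ hx R hR
    -- In dimension 0 no sample could be nonzero, and there is at least one sample.
    have hd : 0 < d := by
      rcases Nat.eq_zero_or_pos d with rfl | hd
      · exact absurd (Subsingleton.elim _ _) (hx ⟨0, hN⟩)
      · exact hd
    rw [RegTyler.realLikelihood_eq]
    refine RegTyler.isStationary_likelihood_iff hN hd hR₀.1 hR hx ?_
    rcases Nat.lt_or_ge 1 d with h | h
    · have : (1 : ℝ) < d := by exact_mod_cast h
      exact .inl (by linarith)
    · exact .inr (by omega)
  · intro R₀ x hR₀ hx R hR
    have hd : 0 < d := by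
      rcases Nat.eq_zero_or_pos d with rfl | hd
      · exact absurd (Subsingleton.elim _ _) (hx ⟨0, hN⟩)
      · exact hd
    rw [RegTyler.complexLikelihood_eq hd hα.2]
    refine RegTyler.isStationary_likelihood_iff hN hd hR₀.1 hR hx ?_
    rcases Nat.lt_or_ge 1 d with h | h
    · have : (1 : ℝ) < d := by exact_mod_cast h
      exact .inl (by linarith [hα.2])
    · exact .inr (by omega)
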